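/- Let $J\subset\mathbb R$ be an interval, $\lambda$ Lebesgue measure on $J$, and $G_g(x)=\int_J x(t)g(t)\,dt$ for $g,x\in L^2(J)$. Let $X_1,X_2,\dots$ and $Y_1,Y_2,\dots$ be two independent sequences of i.i.d. random functions (random elements of $L^2(J)$) with laws $\mathcal L(X)$ and $\mathcal L(Y)$. Let $\mathcal G\subset L^2(J)$ be such that (i) there is $F:J\to\mathbb R$ with $\|F\|^2=\int_J F^2(t)\,dt<\infty$ and $|g(t)|<F(t)$ on $J$ for all $g\in\mathcal G$; (ii) $\int_J X^2(t)\,dt\le M$ almost surely for some constant $M>0$, where $X\sim\mathcal L(X)$; (iii) $\int_0^1\sqrt{\log N_2(\epsilon\|F\|,\mathcal G,\lambda)}\,d\epsilon<\infty$, where $N_2(\delta,\mathcal G,\lambda)$ is the least number of functions in $L^2(J)$ such that every $g\in\mathcal G$ is at $L^2(J)$-distance less than $\delta$ from one of them. Let the sample sizes $m=m_N$ and $n=n_N$ tend to infinity as $N\to\infty$. For each $N$ let $\tilde{\mathbf g}=(\tilde g_1,\dots,\tilde g_k)$ be random functions with values in $\mathcal G$ (possibly depending on the two samples) which converge in probability,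 in $L^2(J)$, to non-random limits $g_{1,\infty},\dots,g_{k,\infty}\in L^2(J)$ for which the covariance matrix of $(G_{g_{1,\infty}}(X),\dots,G_{g_{k,\infty}}(X))$ is nonsingular. Put $$\nu_X(G_g)=\frac1{\sqrt m}\sum_{i\le m}\bigl(G_g(X_i)-\mathbb E\,G_g(X)\bigr),\qquad \nu_Y(G_g)=\frac1{\sqrt n}\sum_{i\le n}\bigl(G_g(Y_i)-\mathbb E\,G_g(Y)\bigr),$$ $\alpha=\sqrt{(n+m)/m}$, $\beta=\sqrt{(n+m)/n}$, and let $\eta\in\mathbb R^k$ be the vector with coordinates $\eta_j=\alpha\,\nu_X(G_{\tilde g_j})-\beta\,\nu_Y(G_{\tilde g_j})$, where the expectations $\mathbb E\,G_g(X)$, $\mathbb E\,G_g(Y)$ are taken for fixed $g$ and then evaluated at $g=\tilde g_j$. Let $\tilde C_X$ and $\tilde C_Y$ be the sample covariance matrices of the vectors $(G_{\tilde g_1}(X_i),\dots,G_{\tilde g_k}(X_i))$, $i\le m$, and $(G_{\tilde g_1}(Y_i),\dots,G_{\tilde g_k}(Y_i))$, $i\le n$, and $$\tilde C=\frac{\alpha^2+\beta^2}{m+n-2}\bigl((m-1)\tilde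 C_X+(n-1)\tilde C_Y\bigr),\qquad Q_n=\eta^{t}\,\tilde C^{-1}\eta .$$ Then, under the null hypothesis $\mathcal L(X)=\mathcal L(Y)$, $Q_n$ converges in distribution, as $N\to\infty$, to a chi-square variable with $k$ degrees of freedom. -/

import Mathlib

open MeasureTheory ProbabilityTheory Filter
open scoped Matrix ENNReal Topology

noncomputable section

namespace TwoSample

/-- The space `L²(J)` of square integrable functions on `J ⊆ ℝ` for Lebesgue measure. -/
abbrev L2 (J : Set ℝ) : Type := Lp ℝ 2 (volume.restrict J)

/-- Random functions are random elements of `L²(J)` with its Borel σ-algebra. -/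
instance instMeasurableSpaceL2 (J : Set ℝ) : MeasurableSpace (L2 J) := borel _

instance instBorelSpaceL2 (J : Set ℝ) : BorelSpace (L2 J) := ⟨rfl⟩

/-- The dot product functional `G_g(x) = ∫_J x(t) g(t) dt`. -/
def dotFun {J : Set ℝ} (g x : L2 J) : ℝ := ∫ t in J, x t * g t

/-- The covering number `N_2(ε, 𝒢, λ)`: the least number of elements of `L²(J)` (not necessarily
in `𝒢`) such that each `f ∈ 𝒢` is at `L²(J)`-distance `< ε` from one of them; `⊤` if there is no
such finite family. -/
def coveringNumber {J : Set ℝ} (ε : ℝ) (𝒢 : Set (L2 J)) : ℕ∞ :=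
  ⨅ (s : Finset (L2 J)) (_ : ∀ f ∈ 𝒢, ∃ g ∈ s, ‖f - g‖ < ε), (s.card : ℕ∞)

/-- Pollard's entropy condition `∫_0^1 √(log N_2(ε‖F‖, 𝒢, λ)) dε < ∞`, with `c = ‖F‖`; the
integrand is `⊤` where the covering number is infinite. -/
def PollardEntropy {J : Set ℝ} (c : ℝ) (𝒢 : Set (L2 J)) : Prop :=
  ∫⁻ ε in Set.Ioc (0 : ℝ) 1,
    (ENNReal.log ((coveringNumber (ε * c) 𝒢 : ℕ∞) : ℝ≥0∞)).toENNReal ^ (1 / 2 : ℝ) < ⊤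

/-- The empirical process `ν(G_g) = m^{-1/2} ∑_{i < m} (G_g(x_i) - 𝔼 G_g(X))`, where `X` has
law `μ`. -/
def empProc {J : Set ℝ} (μ : Measure (L2 J)) (x : ℕ → L2 J) (m : ℕ) (g : L2 J) : ℝ :=
  1 / √(m : ℝ) * ∑ i ∈ Finset.range m, (dotFun g (x i) - ∫ z, dotFun g z ∂μ)

/-- `α(m,n) = √(n+m) / √m`. -/
def alpha (m n : ℕ) : ℝ := √((n : ℝ) + m) / √(m : ℝ)

/-- `β(m,n) = √(n+m) / √n`. -/
def beta (m n : ℕ) : ℝ := √((n : ℝ) + m) / √(n : ℝ)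

/-- The vector `η(m,n) = α ν_X(G(𝐠)) - β ν_Y(G(𝐠))`. -/
def eta {J : Set ℝ} {k : ℕ} (μX μY : Measure (L2 J)) (x y : ℕ → L2 J) (m n : ℕ)
    (g : Fin k → L2 J) : Fin k → ℝ :=
  fun j => alpha m n * empProc μX x m (g j) - beta m n * empProc μY y n (g j)

/-- The sample mean of `G_g(x_i)`, `i < m`. -/
def sampleMean {J : Set ℝ} (x : ℕ → L2 J) (m : ℕ) (g : L2 J) : ℝ :=
  (∑ i ∈ Finset.range m, dotFun g (x i)) / m

/-- The sample covariance matrix of the vectors `(G_{g_1}(x_i), …, G_{g_k}(x_i))`, `i < m`. -/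
def sampleCov {J : Set ℝ} {k : ℕ} (x : ℕ → L2 J) (m : ℕ) (g : Fin k → L2 J) :
    Matrix (Fin k) (Fin k) ℝ :=
  Matrix.of fun j l =>
    (∑ i ∈ Finset.range m,
      (dotFun (g j) (x i) - sampleMean x m (g j)) * (dotFun (g l) (x i) - sampleMean x m (g l)))
      / ((m : ℝ) - 1)

/-- The multiple by `α² + β²` of the pooled sample covariance matrix. -/
def pooledCov {J : Set ℝ} {k : ℕ} (x y : ℕ → L2 J) (m n : ℕ) (g : Fin k → L2 J) :
    Matrix (Fin k) (Fin k) ℝ :=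
  ((alpha m n ^ 2 + beta m n ^ 2) / ((m : ℝ) + n - 2)) •
    (((m : ℝ) - 1) • sampleCov x m g + ((n : ℝ) - 1) • sampleCov y n g)

/-- The quadratic form `ηᵗ (C̃(𝐠))⁻¹ η`. -/
def quadForm {J : Set ℝ} {k : ℕ} (μX μY : Measure (L2 J)) (x y : ℕ → L2 J) (m n : ℕ)
    (g : Fin k → L2 J) : ℝ :=
  eta μX μY x y m n g ⬝ᵥ ((pooledCov x y m n g)⁻¹ *ᵥ eta μX μY x y m n g)

/-- The covariance matrix of `(G_{g_1}(X), …, G_{g_k}(X))`, where `X` has law `μ`. -/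
def covMatrix {J : Set ℝ} {k : ℕ} (μ : Measure (L2 J)) (g : Fin k → L2 J) :
    Matrix (Fin k) (Fin k) ℝ :=
  Matrix.of fun j l => covariance (dotFun (g j)) (dotFun (g l)) μ

/-- The chi-square law with `k` degrees of freedom: the law of the sum of the squares of `k`
independent standard normal variables. -/
def chiSquare (k : ℕ) : Measure ℝ :=
  (Measure.pi fun _ : Fin k => gaussianReal 0 1).map fun z => ∑ i, z i ^ 2

instance instIsProbabilityMeasureChiSquare (k : ℕ) : IsProbabilityMeasure (chiSquare k) :=
  Measure.isProbabilityMeasure_map (by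
    have h : Measurable fun z : Fin k → ℝ => ∑ i, z i ^ 2 := by fun_prop
    exact h.aemeasurable)

end TwoSample

end

/-!
The functional `G_g` is linear in `g`, so the empirical process is the inner product of `g` with a
normalized sum in `L²(J)` that is bounded in second moment. The random functions can therefore be
replaced by their limits, and the envelope and entropy conditions are not needed.
-/

/-! `empProc_eq_inner` writes `ν(G_g)` as the inner product of `g` with one random vector `S` of
`L²(J)`. Independence and boundedness give a bound on `𝔼‖S‖²` uniform in the sample size
(`integrable_norm_sq_normalizedSum_and_le`), so replacing `g̃` by its limit changes `η / √(α² + β²)`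
by a quantity tending to zero in probability.

At fixed functions, Cramér–Wold reduces to the scalar central limit theorem. If `n / (n + m) → p`,
the two samples get weights `√p` and `-√(1 - p)`, whose squares add up to 1, so under the null
hypothesis the limit is Gaussian with covariance `C = BᵀB`, whatever `p` is
(`tendstoInDistribution_scaledEta_const`).

The pooled covariance is a continuous function of `g̃`, the sample means and the means of the
operators `g ↦ ⟪x, g⟫ x`. Strong laws in Banach spaces therefore give its limit `C` outside a null
set independent of `g` (`tendsto_pooledSampleCov`). By Slutsky the statistic tends to `(Bᵀz)ᵗ
(BᵀB)⁻¹ (Bᵀz) = ∑ zᵢ²` with `z` standard normal.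

Almost sure convergence of `g̃` and convergence of the proportion are obtained along subsequences,
which suffices because the limit law is always the same. -/

noncomputable section

namespace TwoSample

/-! ### Convergence in distribution and in probability -/

section Limits

variable {Ω Ω' : Type*} [MeasurableSpace Ω] [MeasurableSpace Ω'] {P : Measure Ω} {P' : Measure Ω'}

/-- Both sides are `𝔼 exp(i t·X)`. The passage to `EuclideanSpace` supplies the inner product that
`charFun` needs. -/
lemma charFun_map_toLp {k : ℕ} {X : Ω → Fin k → ℝ} (hX : AEMeasurable X P)
    (t : EuclideanSpace ℝ (Fin k)) :
    charFun (P.map fun ω => WithLp.toLp 2 (X ω)) t =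
      charFun (P.map fun ω => t.ofLp ⬝ᵥ X ω) 1 := by
  have hdot : AEMeasurable (fun ω => t.ofLp ⬝ᵥ X ω) P := by
    have : Continuous fun x : Fin k → ℝ => t.ofLp ⬝ᵥ x := by fun_prop
    exact this.measurable.comp_aemeasurable hX
  rw [charFun_apply, charFun_apply, integral_map (by fun_prop) (by fun_prop),
    integral_map hdot (by fun_prop)]
  simp [EuclideanSpace.inner_eq_star_dotProduct]

variable [IsProbabilityMeasure P] [IsProbabilityMeasure P']

/-- The **Cramér–Wold device**: random vectors converge in distribution as soon as all their linear
combinations do. -/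
lemma tendstoInDistribution_of_forall_dotProduct {k : ℕ} {X : ℕ → Ω → Fin k → ℝ}
    {Z : Ω' → Fin k → ℝ} (hX : ∀ N, AEMeasurable (X N) P) (hZ : AEMeasurable Z P')
    (h : ∀ t : Fin k → ℝ, TendstoInDistribution (fun N ω => t ⬝ᵥ X N ω) atTop
      (fun ω => t ⬝ᵥ Z ω) (fun _ => P) P') :
    TendstoInDistribution X atTop Z (fun _ => P) P' := by
  have key : TendstoInDistribution (fun N ω => WithLp.toLp 2 (X N ω)) atTop
      (fun ω => WithLp.toLp 2 (Z ω)) (fun _ => P) P' := by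
    refine ⟨fun N => by have := hX N; fun_prop, by fun_prop, ?_⟩
    refine ProbabilityMeasure.tendsto_iff_tendsto_charFun.2 fun t => ?_
    have ht := ProbabilityMeasure.tendsto_iff_tendsto_charFun.1 (h t.ofLp).tendsto 1
    simpa [charFun_map_toLp (hX _), charFun_map_toLp hZ] using ht
  exact key.continuous_comp (g := fun x : EuclideanSpace ℝ (Fin k) => x.ofLp) (by fun_prop)

lemma tendstoInMeasure_const_of_tendsto {a : ℕ → ℝ} {a₀ : ℝ} (ha : Tendsto a atTop (𝓝 a₀)) :
    TendstoInMeasure P (fun N (_ : Ω) => a N) atTop fun _ => a₀ :=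
  tendstoInMeasure_of_tendsto_ae (fun _ => aestronglyMeasurable_const) (ae_of_all _ fun _ => ha)

lemma tendsto_charFun_map_const_mul {A : ℕ → Ω → ℝ} {G : Ω' → ℝ} {v : NNReal} {a : ℕ → ℝ} {a₀ : ℝ}
    (hG : HasLaw G (gaussianReal 0 v) P')
    (hA : TendstoInDistribution A atTop G (fun _ => P) P') (ha : Tendsto a atTop (𝓝 a₀)) (t : ℝ) :
    Tendsto (fun N => charFun (P.map fun ω => a N * A N ω) t) atTop
      (𝓝 (Complex.exp (-(v * (a₀ * t) ^ 2 / 2)))) := by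
  have h := hA.continuous_comp_prodMk_of_tendstoInMeasure_const (g := fun p : ℝ × ℝ => p.2 * p.1)
    (by fun_prop) (tendstoInMeasure_const_of_tendsto ha) (fun _ => aemeasurable_const)
  have h' := ProbabilityMeasure.tendsto_iff_tendsto_charFun.1 h.tendsto t
  simp only [ProbabilityMeasure.coe_mk] at h'
  rw [charFun_map_mul_comp hG.aemeasurable, hG.map_eq, charFun_gaussianReal] at h'
  simpa using h'

/-- A combination, with normalized coefficients, of two independent asymptotically Gaussian
sequences has the same Gaussian limit. -/
lemma tendstoInDistribution_gaussian_add {A B : ℕ → Ω → ℝ} {G : Ω' → ℝ} {v : NNReal}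
    {a b : ℕ → ℝ} {a₀ b₀ : ℝ} (hG : HasLaw G (gaussianReal 0 v) P')
    (hA : TendstoInDistribution A atTop G (fun _ => P) P')
    (hB : TendstoInDistribution B atTop G (fun _ => P) P')
    (hAB : ∀ N, IndepFun (A N) (B N) P) (ha : Tendsto a atTop (𝓝 a₀))
    (hb : Tendsto b atTop (𝓝 b₀)) (hab : a₀ ^ 2 + b₀ ^ 2 = 1) :
    TendstoInDistribution (fun N ω => a N * A N ω + b N * B N ω) atTop G (fun _ => P) P' := by
  have mA := hA.forall_aemeasurable
  have mB := hB.forall_aemeasurable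
  refine ⟨fun N => ((mA N).const_mul _).add ((mB N).const_mul _), hG.aemeasurable, ?_⟩
  refine ProbabilityMeasure.tendsto_iff_tendsto_charFun.2 fun t => ?_
  have hprod := (tendsto_charFun_map_const_mul hG hA ha t).mul
    (tendsto_charFun_map_const_mul hG hB hb t)
  simp only [ProbabilityMeasure.coe_mk]
  rw [hG.map_eq, charFun_gaussianReal]
  convert hprod using 2
  · rename_i N
    have hi : IndepFun (fun ω => a N * A N ω) (fun ω => b N * B N ω) P :=
      (hAB N).comp (φ := fun x => a N * x) (ψ := fun x => b N * x) (by fun_prop) (by fun_prop)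
    rw [hi.charFun_map_fun_add_eq_mul ((mA N).const_mul _) ((mB N).const_mul _)]
    rfl
  · rw [← Complex.exp_add]
    congr 1
    have : (a₀ : ℂ) ^ 2 + (b₀ : ℂ) ^ 2 = 1 := by exact_mod_cast hab
    push_cast
    -- The two exponents add up to `-v (a₀² + b₀²) t² / 2`.
    linear_combination (v * t ^ 2 / 2 : ℂ) * this

lemma hasLaw_dotProduct_gaussian {k : ℕ} (c : Fin k → ℝ) :
    HasLaw (fun z : Fin k → ℝ => c ⬝ᵥ z) (gaussianReal 0 (c ⬝ᵥ c).toNNReal)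
      (Measure.pi fun _ : Fin k => gaussianReal 0 1) := by
  have hm : Measurable fun z : Fin k → ℝ => c ⬝ᵥ z :=
    (by fun_prop : Continuous fun z : Fin k → ℝ => c ⬝ᵥ z).measurable
  refine ⟨hm.aemeasurable, Measure.ext_of_charFun ?_⟩
  ext t
  have h := charFun_map_toLp (P := Measure.pi fun _ : Fin k => gaussianReal 0 1)
    (X := fun z => z) aemeasurable_id (WithLp.toLp 2 (t • c))
  -- Absorbing `t` into the vector turns the scalar characteristic function at `t` into one at 1,
  -- the form given by `charFun_map_toLp`.
  have h1 : charFun ((Measure.pi fun _ : Fin k => gaussianReal 0 1).map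
      fun z => c ⬝ᵥ z) t = charFun ((Measure.pi fun _ : Fin k => gaussianReal 0 1).map
      fun z => (t • c) ⬝ᵥ z) 1 := by
    have := charFun_map_mul_comp (μ := Measure.pi fun _ : Fin k => gaussianReal 0 1)
      hm.aemeasurable t 1
    simp only [smul_dotProduct, smul_eq_mul]
    rw [this, mul_one]
  rw [h1, ← h, map_pi_eq_stdGaussian, charFun_stdGaussian, charFun_gaussianReal,
    ← Complex.ofReal_pow, EuclideanSpace.real_norm_sq_eq]
  have h0 : 0 ≤ c ⬝ᵥ c := Finset.sum_nonneg fun i _ => mul_self_nonneg _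
  congr 1
  have : ∑ i, (WithLp.toLp 2 (t • c)).ofLp i ^ 2 = (c ⬝ᵥ c) * t ^ 2 := by
    simp only [dotProduct, Finset.sum_mul]
    exact Finset.sum_congr rfl fun i _ => by simp; ring
  simp only [this, Real.coe_toNNReal _ h0]
  push_cast
  ring

/-- The product of an `L¹`-bounded sequence and a sequence tending to zero in probability tends to
zero in probability. -/
lemma tendstoInMeasure_mul_of_integral_le {R D : ℕ → Ω → ℝ} {K : ℝ} (hR0 : ∀ N ω, 0 ≤ R N ω)
    (hR : ∀ N, Integrable (R N) P) (hRK : ∀ N, ∫ ω, R N ω ∂P ≤ K)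
    (hD : TendstoInMeasure P D atTop 0) :
    TendstoInMeasure P (fun N ω => R N ω * D N ω) atTop 0 := by
  rw [tendstoInMeasure_iff_measureReal_norm] at hD ⊢
  intro ε hε
  have hK : 0 ≤ K := (integral_nonneg (hR0 0)).trans (hRK 0)
  rw [Metric.tendsto_atTop]
  intro δ hδ
  -- Markov's inequality gives `P(R ≥ r) ≤ K / r < (K + 1) / r = δ / 2`; using `K + 1` keeps `r`
  -- positive when `K = 0`. If `R < r`, then `R |D| ≥ ε` forces `|D| ≥ ε / r`.
  set r : ℝ := 2 * (K + 1) / δ with hr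
  have hr0 : 0 < r := by positivity
  obtain ⟨N₀, hN₀⟩ := Metric.tendsto_atTop.1 (hD (ε / r) (by positivity)) (δ / 2) (by positivity)
  refine ⟨N₀, fun N hN => ?_⟩
  have h1 := hN₀ N hN
  simp only [Real.dist_eq, sub_zero, abs_of_nonneg measureReal_nonneg, Pi.zero_apply] at h1 ⊢
  have h2 : P.real {ω | r ≤ R N ω} < δ / 2 := by
    have := mul_meas_ge_le_integral_of_nonneg (ae_of_all P (hR0 N)) (hR N) r
    have h3 : r * P.real {ω | r ≤ R N ω} < K + 1 := by linarith [hRK N]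
    have h4 : P.real {ω | r ≤ R N ω} < (K + 1) / r := by
      rw [lt_div_iff₀ hr0]; linarith
    convert h4 using 1
    rw [hr]; field_simp
  calc P.real {ω | ε ≤ ‖R N ω * D N ω‖}
      ≤ P.real ({ω | r ≤ R N ω} ∪ {ω | ε / r ≤ ‖D N ω‖}) := by
        refine measureReal_mono fun ω hω => ?_
        simp only [Set.mem_ofPred_eq, Set.mem_union] at hω ⊢
        by_contra! hcon
        obtain ⟨h3, h4⟩ := hcon
        rw [norm_mul, Real.norm_of_nonneg (hR0 N ω)] at hω
        rw [lt_div_iff₀ hr0] at h4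
        nlinarith [norm_nonneg (D N ω), hR0 N ω]
    _ ≤ P.real {ω | r ≤ R N ω} + P.real {ω | ε / r ≤ ‖D N ω‖} := measureReal_union_le _ _
    _ < δ := by linarith

end Limits

/-! ### Rank one operators, whose mean encodes all second moments at once -/

section RankOne

variable {H : Type*} [NormedAddCommGroup H] [InnerProductSpace ℝ H]

/-- The rank one operator `g ↦ ⟪x, g⟫ x`. -/
def rankOneOp (x : H) : H →L[ℝ] H := (innerSL ℝ x).smulRight x

lemma inner_rankOneOp (x g h : H) : inner ℝ (rankOneOp x g) h = inner ℝ x g * inner ℝ x h := by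
  simp [rankOneOp, real_inner_smul_left]

lemma continuous_rankOneOp : Continuous (rankOneOp : H → H →L[ℝ] H) := by
  have h : Continuous fun x : H => ContinuousLinearMap.smulRightL ℝ H H (innerSL ℝ x) x := by
    fun_prop
  exact h

/-- The operator norm is `‖x‖²`, hence bounded. Continuity on the separable space `H` gives strong
measurability, even if the operator space is not separable. -/
lemma integrable_rankOneOp [SecondCountableTopology H] [MeasurableSpace H] [BorelSpace H]
    {μ : Measure H} [IsProbabilityMeasure μ] {M : ℝ} (hμM : ∀ᵐ x ∂μ, ‖x‖ ^ 2 ≤ M) :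
    Integrable (fun x : H => rankOneOp x) μ := by
  refine Integrable.of_bound continuous_rankOneOp.aestronglyMeasurable M ?_
  filter_upwards [hμM] with x hx
  simpa [rankOneOp, ContinuousLinearMap.norm_smulRight_apply, ← sq] using hx

end RankOne

/-! ### Integrability and the strong law for random vectors -/

lemma ae_norm_le_sqrt {H : Type*} [NormedAddCommGroup H] [MeasurableSpace H] {μ : Measure H} {M : ℝ}
    (hμM : ∀ᵐ x ∂μ, ‖x‖ ^ 2 ≤ M) : ∀ᵐ x ∂μ, ‖x‖ ≤ √M := by
  filter_upwards [hμM] with x hx using Real.le_sqrt_of_sq_le hx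

/-- The strong law of large numbers for an integrable continuous function of an i.i.d. sample. -/
lemma ae_tendsto_average {Ω H V : Type*} [MeasurableSpace Ω] {P : Measure Ω}
    [NormedAddCommGroup H] [MeasurableSpace H] [BorelSpace H] {μ : Measure H} {X : ℕ → Ω → H}
    [NormedAddCommGroup V] [NormedSpace ℝ V] [CompleteSpace V]
    [MeasurableSpace V] [BorelSpace V] {φ : H → V} (hφ : Continuous φ) (hφi : Integrable φ μ)
    (hX : ∀ i, HasLaw (X i) μ P) (hind : iIndepFun X P) :
    ∀ᵐ ω ∂P, Tendsto (fun n : ℕ => (n : ℝ)⁻¹ • ∑ i ∈ Finset.range n, φ (X i ω)) atTop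
      (𝓝 (∫ z, φ z ∂μ)) := by
  have hmap : ∀ i, P.map (X i) = μ := fun i => (hX i).map_eq
  have h := strong_law_ae (μ := P) (fun i ω => φ (X i ω))
    ((integrable_map_measure (by rw [hmap]; exact hφi.1) (hX 0).aemeasurable).1
      (by rw [hmap]; exact hφi))
    (fun i j hij => (hind.indepFun hij).comp hφ.measurable hφ.measurable)
    (fun i => IdentDistrib.comp (u := φ)
      ⟨(hX i).aemeasurable, (hX 0).aemeasurable, by rw [hmap, hmap]⟩ hφ.measurable)
  rwa [← (hX 0).integral_comp hφi.1]

lemma integrable_id_of_norm_sq_le {H : Type*} [NormedAddCommGroup H] [MeasurableSpace H]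
    [SecondCountableTopology H] [BorelSpace H] {μ : Measure H} [IsProbabilityMeasure μ] {M : ℝ}
    (hμM : ∀ᵐ x ∂μ, ‖x‖ ^ 2 ≤ M) : Integrable (fun x : H => x) μ :=
  Integrable.of_bound aestronglyMeasurable_id (√M) (ae_norm_le_sqrt hμM)

lemma integrable_inner_of_memLp {Ω H : Type*} [MeasurableSpace Ω] {P : Measure Ω}
    [NormedAddCommGroup H] [InnerProductSpace ℝ H] {f g : Ω → H} (hf : MemLp f 2 P)
    (hg : MemLp g 2 P) : Integrable (fun ω => inner ℝ (f ω) (g ω)) P := by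
  refine ((hf.integrable_norm_pow (by norm_num)).add
    (hg.integrable_norm_pow (by norm_num))).mono' (hf.1.inner hg.1) (ae_of_all _ fun ω => ?_)
  simp only [Pi.add_apply]
  nlinarith [norm_inner_le_norm (𝕜 := ℝ) (f ω) (g ω), sq_nonneg (‖f ω‖ - ‖g ω‖),
    sq_nonneg ‖f ω‖, sq_nonneg ‖g ω‖]

/-! ### Second moments of normalized sums -/

section Sample

variable {Ω : Type*} [MeasurableSpace Ω] {P : Measure Ω} [IsProbabilityMeasure P]
  {H : Type*} [NormedAddCommGroup H] [InnerProductSpace ℝ H] [CompleteSpace H]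
  [MeasurableSpace H] [BorelSpace H]

/-- The second moment of a sum of independent centered random vectors. -/
lemma integral_norm_sq_sum {Z : ℕ → Ω → H} (hZ : ∀ i, MemLp (Z i) 2 P)
    (h0 : ∀ i, ∫ ω, Z i ω ∂P = 0) (hind : iIndepFun Z P) (m : ℕ) :
    ∫ ω, ‖∑ i ∈ Finset.range m, Z i ω‖ ^ 2 ∂P
      = ∑ i ∈ Finset.range m, ∫ ω, ‖Z i ω‖ ^ 2 ∂P := by
  induction m with
  | zero => simp
  | succ m ih =>
    have hS : MemLp (fun ω => ∑ i ∈ Finset.range m, Z i ω) 2 P :=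
      memLp_finsetSum _ fun i _ => hZ i
    have hin : ∀ i, Integrable (fun ω => inner ℝ (Z i ω) (Z m ω)) P := fun i =>
      integrable_inner_of_memLp (hZ i) (hZ m)
    -- Independence turns the expected inner product into the inner product of the expectations, and
    -- `Z m` is centered.
    have hcross : ∫ ω, inner ℝ (∑ i ∈ Finset.range m, Z i ω) (Z m ω) ∂P = 0 := by
      simp_rw [sum_inner]
      rw [integral_finsetSum _ fun i _ => hin i]
      refine Finset.sum_eq_zero fun i hi => ?_
      have hne : i ≠ m := (Finset.mem_range.1 hi).ne
      have := (hind.indepFun hne).integral_bilin ((hZ i).integrable (by norm_num))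
        ((hZ m).integrable (by norm_num)) (innerSL ℝ)
      rw [h0 m, map_zero] at this
      exact this
    have hcrossI : Integrable (fun ω => inner ℝ (∑ i ∈ Finset.range m, Z i ω) (Z m ω)) P :=
      integrable_inner_of_memLp hS (hZ m)
    have hSI : Integrable (fun ω => ‖∑ i ∈ Finset.range m, Z i ω‖ ^ 2
        + 2 * inner ℝ (∑ i ∈ Finset.range m, Z i ω) (Z m ω)) P :=
      (hS.integrable_norm_pow (by norm_num)).add (hcrossI.const_mul 2)
    simp_rw [Finset.sum_range_succ, norm_add_sq_real]
    rw [integral_add hSI ((hZ m).integrable_norm_pow (by norm_num)),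
      integral_add (hS.integrable_norm_pow (by norm_num)) (hcrossI.const_mul 2),
      integral_const_mul, hcross, ih]
    simp

variable {μ : Measure H} {X : ℕ → Ω → H}

/-- The normalized sum `m^{-1/2} ∑_{i < m} (x_i - 𝔼 X)`, where `X` has law `μ`. -/
def normalizedSum (μ : Measure H) (x : ℕ → H) (m : ℕ) : H :=
  (1 / √(m : ℝ)) • ∑ i ∈ Finset.range m, (x i - ∫ z, z ∂μ)

variable {M : ℝ} [SecondCountableTopology H]

/-- The centered variables have norm at most `2√M` and are orthogonal in `L²(P)`, so the squared sum
has expectation at most `m (2√M)²`, and the normalization cancels `m`. This uniform bound is what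
permits random `g`. -/
lemma integrable_norm_sq_normalizedSum_and_le [IsProbabilityMeasure μ]
    (hμM : ∀ᵐ x ∂μ, ‖x‖ ^ 2 ≤ M) (hX : ∀ i, HasLaw (X i) μ P) (hind : iIndepFun X P) (m : ℕ) :
    Integrable (fun ω => ‖normalizedSum μ (fun i => X i ω) m‖ ^ 2) P ∧
      ∫ ω, ‖normalizedSum μ (fun i => X i ω) m‖ ^ 2 ∂P ≤ (2 * √M) ^ 2 := by
  set c : H := ∫ z, z ∂μ with hc
  have hcM : ‖c‖ ≤ √M := by
    have := norm_integral_le_of_norm_le_const (μ := μ) (f := fun z : H => z) (ae_norm_le_sqrt hμM)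
    simpa using this
  have hbd : ∀ i, ∀ᵐ ω ∂P, ‖X i ω - c‖ ≤ 2 * √M := fun i => by
    have h1 : ∀ᵐ x ∂(P.map (X i)), ‖x‖ ≤ √M := by
      rw [(hX i).map_eq]; exact ae_norm_le_sqrt hμM
    filter_upwards [ae_of_ae_map (hX i).aemeasurable h1] with ω hω
    linarith [norm_sub_le (X i ω) c]
  have hmeas : ∀ i, AEMeasurable (fun ω => X i ω - c) P := fun i =>
    (hX i).aemeasurable.sub_const c
  have hZ : ∀ i, MemLp (fun ω => X i ω - c) 2 P := fun i =>
    MemLp.of_bound (hmeas i).aestronglyMeasurable _ (hbd i)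
  have hXint : ∀ i, Integrable (X i) P := fun i => by
    have := ((hZ i).integrable (by norm_num)).add (integrable_const c)
    exact this.congr (ae_of_all _ fun ω => sub_add_cancel _ _)
  have h0 : ∀ i, ∫ ω, (X i ω - c) ∂P = 0 := fun i => by
    rw [integral_sub (hXint i) (integrable_const c), (hX i).integral_eq]
    simp [hc]
  have hind' : iIndepFun (fun i ω => X i ω - c) P :=
    hind.comp (fun _ x => x - c) (fun _ => by fun_prop)
  have heq : ∀ ω, ‖normalizedSum μ (fun i => X i ω) m‖ ^ 2
      = (m : ℝ)⁻¹ * ‖∑ i ∈ Finset.range m, (X i ω - c)‖ ^ 2 := fun ω => by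
    rw [normalizedSum, norm_smul, mul_pow]
    congr 1
    simp
  simp_rw [heq]
  refine ⟨((memLp_finsetSum _ fun i _ => hZ i).integrable_norm_pow (by norm_num)).const_mul _, ?_⟩
  rw [integral_const_mul, integral_norm_sq_sum hZ h0 hind']
  have hle : ∑ i ∈ Finset.range m, ∫ ω, ‖X i ω - c‖ ^ 2 ∂P ≤ m * (2 * √M) ^ 2 := by
    calc _ ≤ ∑ _i ∈ Finset.range m, (2 * √M) ^ 2 := by
          refine Finset.sum_le_sum fun i _ => ?_
          calc ∫ ω, ‖X i ω - c‖ ^ 2 ∂P ≤ ∫ _ω, (2 * √M) ^ 2 ∂P := by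
                refine integral_mono_ae ((hZ i).integrable_norm_pow (by norm_num))
                  (integrable_const _) ?_
                filter_upwards [hbd i] with ω hω
                exact pow_le_pow_left₀ (norm_nonneg _) hω 2
            _ = _ := by simp
      _ = _ := by simp
  -- For the empty sample the left side is 0.
  rcases Nat.eq_zero_or_pos m with rfl | hm
  · simp
  · have hm' : (0 : ℝ) < m := by exact_mod_cast hm
    rw [inv_mul_le_iff₀ hm']
    exact hle

end Sample

lemma aemeasurable_normalizedSum {Ω H : Type*} [MeasurableSpace Ω] {P : Measure Ω}
    [NormedAddCommGroup H] [InnerProductSpace ℝ H] [SecondCountableTopology H] [MeasurableSpace H]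
    [BorelSpace H] {μ : Measure H} {X : ℕ → Ω → H} (hX : ∀ i, AEMeasurable (X i) P) (m : ℕ) :
    AEMeasurable (fun ω => normalizedSum μ (fun i => X i ω) m) P :=
  (Finset.aemeasurable_fun_sum _ fun i _ => (hX i).sub_const _).const_smul _

/-- Evaluation of an operator at a vector is jointly continuous in operator norm, so the arguments
may move with `N`. -/
lemma tendsto_inner_apply_sub_inner_mul_inner {H : Type*} [NormedAddCommGroup H]
    [InnerProductSpace ℝ H] {A : ℕ → H →L[ℝ] H} {A₀ : H →L[ℝ] H} {c g h : ℕ → H} {c₀ g₀ h₀ : H}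
    (hA : Tendsto A atTop (𝓝 A₀)) (hc : Tendsto c atTop (𝓝 c₀)) (hg : Tendsto g atTop (𝓝 g₀))
    (hh : Tendsto h atTop (𝓝 h₀)) :
    Tendsto (fun N => inner ℝ (A N (g N)) (h N) - inner ℝ (c N) (g N) * inner ℝ (c N) (h N)) atTop
      (𝓝 (inner ℝ (A₀ g₀) h₀ - inner ℝ c₀ g₀ * inner ℝ c₀ h₀)) := by
  have happ : Tendsto (fun N => A N (g N)) atTop (𝓝 (A₀ g₀)) :=
    Tendsto.comp (g := fun q : (H →L[ℝ] H) × H => q.1 q.2)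
      (isBoundedBilinearMap_apply.continuous.tendsto (_, _)) (hA.prodMk_nhds hg)
  exact (happ.inner hh).sub ((hc.inner hg).mul (hc.inner hh))

/-! ### The functional `G_g` and its covariance matrix -/

section Functional

variable {J : Set ℝ} {μ : Measure (L2 J)} {k : ℕ}

lemma dotFun_eq_inner (g x : L2 J) : dotFun g x = inner ℝ x g := by
  rw [L2.inner_def]
  refine integral_congr_ae (ae_of_all _ fun t => ?_)
  simp [mul_comm]

lemma measurable_dotFun (g : L2 J) : Measurable (dotFun g) := by
  have h : dotFun g = fun x => inner ℝ x g := funext (dotFun_eq_inner g)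
  rw [h]
  exact (by fun_prop : Continuous fun x : L2 J => inner ℝ x g).measurable

instance instSecondCountableTopologyL2 (J : Set ℝ) : SecondCountableTopology (L2 J) :=
  haveI : Fact ((2 : ℝ≥0∞) ≠ ∞) := ⟨by simp⟩
  Lp.SecondCountableTopology

lemma aemeasurable_dotFun {Ω : Type*} [MeasurableSpace Ω] {P : Measure Ω} {g x : Ω → L2 J}
    (hg : AEMeasurable g P) (hx : AEMeasurable x P) :
    AEMeasurable (fun ω => dotFun (g ω) (x ω)) P := by
  simp_rw [dotFun_eq_inner]
  exact hx.inner hg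

lemma dotFun_sum_smul (t : Fin k → ℝ) (g : Fin k → L2 J) (x : L2 J) :
    dotFun (∑ j, t j • g j) x = ∑ j, t j * dotFun (g j) x := by
  simp_rw [dotFun_eq_inner, inner_sum, real_inner_smul_right]

lemma integral_dotFun (hi : Integrable (fun z : L2 J => z) μ) (g : L2 J) :
    ∫ z, dotFun g z ∂μ = inner ℝ (∫ z, z ∂μ) g := by
  simp_rw [dotFun_eq_inner, real_inner_comm g]
  exact integral_inner hi g

lemma empProc_eq_inner (hi : Integrable (fun z : L2 J => z) μ) (x : ℕ → L2 J) (m : ℕ) (g : L2 J) :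
    empProc μ x m g = inner ℝ (normalizedSum μ x m) g := by
  rw [empProc, integral_dotFun hi]
  simp only [normalizedSum, real_inner_smul_left, sum_inner, inner_sub_left, dotFun_eq_inner]

lemma measurable_empProc (m : ℕ) (g : L2 J) :
    Measurable fun x : ℕ → L2 J => empProc μ x m g := by
  unfold empProc
  refine Measurable.const_mul (Finset.measurable_sum _ fun i _ => ?_) _
  exact ((measurable_dotFun g).comp (measurable_pi_apply i)).sub_const _

variable [IsProbabilityMeasure μ] {M : ℝ}

lemma memLp_dotFun (hμM : ∀ᵐ x ∂μ, ‖x‖ ^ 2 ≤ M) (g : L2 J) : MemLp (dotFun g) 2 μ := by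
  refine MemLp.of_bound (measurable_dotFun g).aestronglyMeasurable (√M * ‖g‖) ?_
  filter_upwards [ae_norm_le_sqrt hμM] with x hx
  rw [dotFun_eq_inner]
  exact (norm_inner_le_norm _ _).trans (by gcongr)

/-- The fixed functions come out of the Bochner integrals. The result is the same continuous
expression in mean operator and mean vector as in `sampleCov_apply_eq`. -/
lemma covMatrix_apply_eq (hμM : ∀ᵐ x ∂μ, ‖x‖ ^ 2 ≤ M) (g : Fin k → L2 J) (j l : Fin k) :
    covMatrix μ g j l = inner ℝ ((∫ z, rankOneOp z ∂μ) (g j)) (g l)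
      - inner ℝ (∫ z, z ∂μ) (g j) * inner ℝ (∫ z, z ∂μ) (g l) := by
  have hop : Integrable (fun z : L2 J => rankOneOp z) μ := integrable_rankOneOp hμM
  have hi := integrable_id_of_norm_sq_le hμM
  rw [covMatrix, Matrix.of_apply, covariance_eq_sub (memLp_dotFun hμM _) (memLp_dotFun hμM _),
    integral_dotFun hi, integral_dotFun hi, ContinuousLinearMap.integral_apply hop,
    real_inner_comm (g l) (∫ z, rankOneOp z (g j) ∂μ), ← integral_inner (hop.apply_continuousLinearMap (g j))]
  congr 1
  refine integral_congr_ae (ae_of_all _ fun z => ?_)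
  simp only [Pi.mul_apply, dotFun_eq_inner]
  rw [real_inner_comm (rankOneOp z (g j)), inner_rankOneOp]

/-- The quadratic form of the covariance matrix is the variance of the linear combination. -/
lemma dotProduct_covMatrix_mulVec (hμM : ∀ᵐ x ∂μ, ‖x‖ ^ 2 ≤ M) (g : Fin k → L2 J)
    (t : Fin k → ℝ) :
    t ⬝ᵥ (covMatrix μ g *ᵥ t) = Var[dotFun (∑ j, t j • g j); μ] := by
  have hL : ∀ j, MemLp (fun x => t j * dotFun (g j) x) 2 μ := fun j =>
    (memLp_dotFun hμM (g j)).const_mul _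
  have h : dotFun (∑ j, t j • g j) = fun x => ∑ j, t j * dotFun (g j) x :=
    funext (dotFun_sum_smul t g)
  rw [← covariance_self (measurable_dotFun _).aemeasurable, h, covariance_fun_sum_fun_sum hL hL]
  simp only [dotProduct, Matrix.mulVec, Finset.mul_sum, covariance_const_mul_left,
    covariance_const_mul_right, covMatrix, Matrix.of_apply]
  refine Finset.sum_congr rfl fun i _ => Finset.sum_congr rfl fun j _ => ?_
  ring

lemma posSemidef_covMatrix (hμM : ∀ᵐ x ∂μ, ‖x‖ ^ 2 ≤ M) (g : Fin k → L2 J) :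
    (covMatrix μ g).PosSemidef := by
  refine Matrix.PosSemidef.of_dotProduct_mulVec_nonneg ?_ fun t => ?_
  · ext i j
    simp [covMatrix, covariance_comm]
  · rw [star_trivial, dotProduct_covMatrix_mulVec hμM]
    exact variance_nonneg _ _

open scoped MatrixOrder in
lemma exists_transpose_mul_self_eq_covMatrix (hμM : ∀ᵐ x ∂μ, ‖x‖ ^ 2 ≤ M) (g : Fin k → L2 J) :
    ∃ B : Matrix (Fin k) (Fin k) ℝ, covMatrix μ g = Bᵀ * B := by
  have hC := posSemidef_covMatrix hμM g
  refine ⟨CFC.sqrt (covMatrix μ g), ?_⟩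
  have hs : (CFC.sqrt (covMatrix μ g))ᵀ = CFC.sqrt (covMatrix μ g) := by
    simpa [IsSelfAdjoint, Matrix.star_eq_conjTranspose] using
      (CFC.sqrt_nonneg (covMatrix μ g)).isSelfAdjoint
  rw [hs, CFC.sqrt_mul_sqrt_self _ hC.nonneg]

end Functional

/-! ### Consistency of the sample covariance matrices -/

section SampleCovariance

variable {J : Set ℝ} {μ : Measure (L2 J)} {k : ℕ} {M : ℝ}

lemma sampleCov_apply_eq (x : ℕ → L2 J) {m : ℕ} (hm : 2 ≤ m) (g : Fin k → L2 J) (j l : Fin k) :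
    ((m : ℝ) - 1) * sampleCov x m g j l = m *
      (inner ℝ (((m : ℝ)⁻¹ • ∑ i ∈ Finset.range m, rankOneOp (x i)) (g j)) (g l)
        - inner ℝ ((m : ℝ)⁻¹ • ∑ i ∈ Finset.range m, x i) (g j)
          * inner ℝ ((m : ℝ)⁻¹ • ∑ i ∈ Finset.range m, x i) (g l)) := by
  have hm2 : (2 : ℝ) ≤ m := by exact_mod_cast hm
  have hm1 : (m : ℝ) - 1 ≠ 0 := by linarith
  have hm0 : (m : ℝ) ≠ 0 := by linarith
  have hmean : ∀ h : L2 J, inner ℝ ((m : ℝ)⁻¹ • ∑ i ∈ Finset.range m, x i) h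
      = sampleMean x m h := fun h => by
    rw [real_inner_smul_left, sum_inner, sampleMean, div_eq_inv_mul]
    simp_rw [dotFun_eq_inner]
  have hsum : ∀ h : L2 J, ∑ i ∈ Finset.range m, dotFun h (x i) = m * sampleMean x m h := fun h => by
    rw [sampleMean, mul_div_cancel₀ _ hm0]
  have hop : inner ℝ (((m : ℝ)⁻¹ • ∑ i ∈ Finset.range m, rankOneOp (x i)) (g j)) (g l)
      = (m : ℝ)⁻¹ * ∑ i ∈ Finset.range m, dotFun (g j) (x i) * dotFun (g l) (x i) := by
    rw [smul_apply, real_inner_smul_left, sum_apply,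
      sum_inner]
    simp_rw [inner_rankOneOp, dotFun_eq_inner]
  rw [hmean, hmean, hop, sampleCov, Matrix.of_apply, mul_div_cancel₀ _ hm1, mul_sub,
    mul_inv_cancel_left₀ hm0]
  simp only [sub_mul, mul_sub, Finset.sum_sub_distrib, ← Finset.mul_sum, ← Finset.sum_mul, hsum,
    Finset.sum_const, Finset.card_range, nsmul_eq_mul]
  ring

/-- The unscaled pooled sample covariance matrix. -/
def pooledSampleCov (x y : ℕ → L2 J) (m n : ℕ) (g : Fin k → L2 J) : Matrix (Fin k) (Fin k) ℝ :=
  ((m : ℝ) + n - 2)⁻¹ • (((m : ℝ) - 1) • sampleCov x m g + ((n : ℝ) - 1) • sampleCov y n g)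

variable [IsProbabilityMeasure μ]

/-- This concerns a single realization: the laws of large numbers enter as hypotheses not involving
`g`, so `g` may depend on the samples. -/
lemma tendsto_sampleCov (hμM : ∀ᵐ x ∂μ, ‖x‖ ^ 2 ≤ M) {x : ℕ → L2 J}
    (hx1 : Tendsto (fun n : ℕ => (n : ℝ)⁻¹ • ∑ i ∈ Finset.range n, x i) atTop (𝓝 (∫ z, z ∂μ)))
    (hx2 : Tendsto (fun n : ℕ => (n : ℝ)⁻¹ • ∑ i ∈ Finset.range n, rankOneOp (x i)) atTop
      (𝓝 (∫ z, rankOneOp z ∂μ)))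
    {m : ℕ → ℕ} (hm : Tendsto m atTop atTop) {g : ℕ → Fin k → L2 J} {gInf : Fin k → L2 J}
    (hg : ∀ j, Tendsto (fun N => g N j) atTop (𝓝 (gInf j))) (j l : Fin k) :
    Tendsto (fun N => ((m N : ℝ))⁻¹ * (((m N : ℝ) - 1) * sampleCov x (m N) (g N) j l)) atTop
      (𝓝 (covMatrix μ gInf j l)) := by
  rw [covMatrix_apply_eq hμM]
  have h1 : Tendsto (fun N => (m N : ℝ)⁻¹ • ∑ i ∈ Finset.range (m N), x i) atTop
      (𝓝 (∫ z, z ∂μ)) := hx1.comp hm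
  have h2 : Tendsto (fun N => (m N : ℝ)⁻¹ • ∑ i ∈ Finset.range (m N), rankOneOp (x i)) atTop
      (𝓝 (∫ z, rankOneOp z ∂μ)) := hx2.comp hm
  have hlim := tendsto_inner_apply_sub_inner_mul_inner h2 h1 (hg j) (hg l)
  refine hlim.congr' ?_
  filter_upwards [hm.eventually_ge_atTop 2] with N hN
  have hm0 : (m N : ℝ) ≠ 0 := by
    have : m N ≠ 0 := by omega
    exact_mod_cast this
  rw [sampleCov_apply_eq x hN, inv_mul_cancel_left₀ hm0]

lemma tendsto_pooledSampleCov (hμM : ∀ᵐ x ∂μ, ‖x‖ ^ 2 ≤ M) {x y : ℕ → L2 J}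
    (hx1 : Tendsto (fun n : ℕ => (n : ℝ)⁻¹ • ∑ i ∈ Finset.range n, x i) atTop (𝓝 (∫ z, z ∂μ)))
    (hx2 : Tendsto (fun n : ℕ => (n : ℝ)⁻¹ • ∑ i ∈ Finset.range n, rankOneOp (x i)) atTop
      (𝓝 (∫ z, rankOneOp z ∂μ)))
    (hy1 : Tendsto (fun n : ℕ => (n : ℝ)⁻¹ • ∑ i ∈ Finset.range n, y i) atTop (𝓝 (∫ z, z ∂μ)))
    (hy2 : Tendsto (fun n : ℕ => (n : ℝ)⁻¹ • ∑ i ∈ Finset.range n, rankOneOp (y i)) atTop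
      (𝓝 (∫ z, rankOneOp z ∂μ)))
    {m n : ℕ → ℕ} (hm : Tendsto m atTop atTop) (hn : Tendsto n atTop atTop) {p : ℝ}
    (hp : Tendsto (fun N => (n N : ℝ) / ((n N : ℝ) + m N)) atTop (𝓝 p))
    {g : ℕ → Fin k → L2 J} {gInf : Fin k → L2 J}
    (hg : ∀ j, Tendsto (fun N => g N j) atTop (𝓝 (gInf j))) :
    Tendsto (fun N => pooledSampleCov x y (m N) (n N) (g N)) atTop (𝓝 (covMatrix μ gInf)) := by
  refine tendsto_pi_nhds.2 fun j => tendsto_pi_nhds.2 fun l => ?_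
  have hmR : Tendsto (fun N => (m N : ℝ)) atTop atTop := tendsto_natCast_atTop_atTop.comp hm
  have hnR : Tendsto (fun N => (n N : ℝ)) atTop atTop := tendsto_natCast_atTop_atTop.comp hn
  -- This factor corrects the denominator `m + n - 2` to `m + n`, leaving a convex combination with
  -- weights tending to `1 - p` and `p`.
  have hs : Tendsto (fun N => 1 - 2 / ((m N : ℝ) + n N)) atTop (𝓝 (1 - 0)) :=
    tendsto_const_nhds.sub ((hmR.atTop_add_atTop hnR).const_div_atTop 2)
  have hs' := hs.inv₀ (by norm_num)
  have hlim := hs'.mul ((((tendsto_const_nhds (x := (1 : ℝ))).sub hp).mul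
    (tendsto_sampleCov hμM hx1 hx2 hm hg j l)).add
      (hp.mul (tendsto_sampleCov hμM hy1 hy2 hn hg j l)))
  -- Both samples have the same limiting covariance, so `p` drops out.
  have hval : ((1 : ℝ) - 0)⁻¹ * ((1 - p) * covMatrix μ gInf j l + p * covMatrix μ gInf j l)
      = covMatrix μ gInf j l := by ring
  rw [hval] at hlim
  refine hlim.congr' ?_
  filter_upwards [hm.eventually_ge_atTop 2, hn.eventually_ge_atTop 2] with N hmN hnN
  have hmN' : (2 : ℝ) ≤ m N := by exact_mod_cast hmN
  have hnN' : (2 : ℝ) ≤ n N := by exact_mod_cast hnN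
  have h1 : (m N : ℝ) ≠ 0 := by linarith
  have h2 : (n N : ℝ) ≠ 0 := by linarith
  have h3 : (m N : ℝ) + n N ≠ 0 := by linarith
  have h3' : (n N : ℝ) + m N ≠ 0 := by linarith
  have h4 : (m N : ℝ) + n N - 2 ≠ 0 := by linarith
  have h5 : (1 - 2 / ((m N : ℝ) + n N))⁻¹ = (m N + n N) / ((m N : ℝ) + n N - 2) := by
    rw [one_sub_div h3, inv_div]
  have h6 : 1 - (n N : ℝ) / (n N + m N) = m N / (m N + n N) := by
    field_simp; ring
  rw [h5, h6, add_comm (n N : ℝ)]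
  simp only [pooledSampleCov, Matrix.smul_apply, Matrix.add_apply, smul_eq_mul]
  field_simp

end SampleCovariance

/-! ### Weights of the two samples -/

section Coefficients

/-- The weight of the first sample in the normalized difference. -/
def coefX (m n : ℕ) : ℝ := alpha m n / √(alpha m n ^ 2 + beta m n ^ 2)

/-- The weight of the second sample in the normalized difference. -/
def coefY (m n : ℕ) : ℝ := beta m n / √(alpha m n ^ 2 + beta m n ^ 2)

lemma abs_div_sqrt_add_sq_le_one (a b : ℝ) : |a / √(a ^ 2 + b ^ 2)| ≤ 1 := by
  rw [abs_div, abs_of_nonneg (Real.sqrt_nonneg _)]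
  refine div_le_one_of_le₀ (Real.le_sqrt_of_sq_le ?_) (Real.sqrt_nonneg _)
  rw [sq_abs]
  linarith [sq_nonneg b]

lemma abs_coefX_le_one (m n : ℕ) : |coefX m n| ≤ 1 := abs_div_sqrt_add_sq_le_one _ _

lemma abs_coefY_le_one (m n : ℕ) : |coefY m n| ≤ 1 := by
  rw [coefY, add_comm]
  exact abs_div_sqrt_add_sq_le_one _ _

/-- Here `α² = (n + m) / m` and `β² = (n + m) / n`, so `α² / (α² + β²) = n / (n + m)`. -/
lemma coefX_eq_sqrt {m n : ℕ} (hm : 0 < m) (hn : 0 < n) :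
    coefX m n = √((n : ℝ) / ((n : ℝ) + m)) := by
  have hm' : (0 : ℝ) < m := by exact_mod_cast hm
  have hn' : (0 : ℝ) < n := by exact_mod_cast hn
  rw [coefX, alpha, beta, ← Real.sqrt_div' _ hm'.le, ← Real.sqrt_div' _ hn'.le,
    Real.sq_sqrt (by positivity), Real.sq_sqrt (by positivity),
    ← Real.sqrt_div' _ (by positivity)]
  congr 1
  field_simp

lemma coefY_eq_sqrt {m n : ℕ} (hm : 0 < m) (hn : 0 < n) :
    coefY m n = √(1 - (n : ℝ) / ((n : ℝ) + m)) := by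
  have hm' : (0 : ℝ) < m := by exact_mod_cast hm
  have hn' : (0 : ℝ) < n := by exact_mod_cast hn
  rw [coefY, alpha, beta, ← Real.sqrt_div' _ hm'.le, ← Real.sqrt_div' _ hn'.le,
    Real.sq_sqrt (by positivity), Real.sq_sqrt (by positivity),
    ← Real.sqrt_div' _ (by positivity)]
  congr 1
  field_simp
  ring

variable {m n : ℕ → ℕ} {p : ℝ}

lemma tendsto_coefX (hm : Tendsto m atTop atTop) (hn : Tendsto n atTop atTop)
    (hp : Tendsto (fun N => (n N : ℝ) / ((n N : ℝ) + m N)) atTop (𝓝 p)) :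
    Tendsto (fun N => coefX (m N) (n N)) atTop (𝓝 √p) := by
  refine hp.sqrt.congr' ?_
  filter_upwards [hm.eventually_gt_atTop 0, hn.eventually_gt_atTop 0] with N hmN hnN
  rw [coefX_eq_sqrt hmN hnN]

lemma tendsto_coefY (hm : Tendsto m atTop atTop) (hn : Tendsto n atTop atTop)
    (hp : Tendsto (fun N => (n N : ℝ) / ((n N : ℝ) + m N)) atTop (𝓝 p)) :
    Tendsto (fun N => coefY (m N) (n N)) atTop (𝓝 √(1 - p)) := by
  refine ((tendsto_const_nhds (x := (1 : ℝ))).sub hp).sqrt.congr' ?_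
  filter_upwards [hm.eventually_gt_atTop 0, hn.eventually_gt_atTop 0] with N hmN hnN
  rw [coefY_eq_sqrt hmN hnN]

end Coefficients

/-! ### Matrix inverses and quadratic forms -/

section MatrixInverse

variable {k : ℕ}

/-- Cramer's rule also holds for singular matrices, where both sides are 0. It gives measurability
everywhere and continuity at invertible matrices. -/
lemma inv_apply_eq (A : Matrix (Fin k) (Fin k) ℝ) (i j : Fin k) :
    A⁻¹ i j = A.det⁻¹ * A.adjugate i j := by
  rw [Matrix.inv_def, Ring.inverse_eq_inv', Matrix.smul_apply, smul_eq_mul]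

/-- The entries of the inverse matrix, as an element of a product of normed spaces. -/
def invEntries (A : Matrix (Fin k) (Fin k) ℝ) : Fin k → Fin k → ℝ := fun i j => A⁻¹ i j

lemma measurable_invEntries :
    Measurable fun A : Fin k → Fin k → ℝ => invEntries (Matrix.of A) := by
  have hof : Continuous fun A : Fin k → Fin k → ℝ => (Matrix.of A : Matrix (Fin k) (Fin k) ℝ) :=
    continuous_id
  refine measurable_pi_lambda _ fun i => measurable_pi_lambda _ fun j => ?_
  simp_rw [invEntries, inv_apply_eq]
  exact (hof.matrix_det.measurable.inv).mul (hof.matrix_adjugate.matrix_elem i j).measurable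

lemma tendsto_invEntries {A : ℕ → Matrix (Fin k) (Fin k) ℝ} {C : Matrix (Fin k) (Fin k) ℝ}
    (hA : Tendsto A atTop (𝓝 C)) (hC : IsUnit C) :
    Tendsto (fun N => invEntries (A N)) atTop (𝓝 (invEntries C)) := by
  have hdet : C.det ≠ 0 := ((Matrix.isUnit_iff_isUnit_det C).1 hC).ne_zero
  refine tendsto_pi_nhds.2 fun i => tendsto_pi_nhds.2 fun j => ?_
  simp_rw [invEntries, inv_apply_eq]
  have h1 : Continuous fun A : Matrix (Fin k) (Fin k) ℝ => A.det := continuous_id.matrix_det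
  have h2 : Continuous fun A : Matrix (Fin k) (Fin k) ℝ => A.adjugate i j :=
    continuous_id.matrix_adjugate.matrix_elem i j
  exact (((h1.tendsto C).comp hA).inv₀ hdet).mul ((h2.tendsto C).comp hA)

lemma inv_smul_of_ne_zero {c : ℝ} (hc : c ≠ 0) (A : Matrix (Fin k) (Fin k) ℝ) :
    (c • A)⁻¹ = c⁻¹ • A⁻¹ := by
  by_cases h : IsUnit A.det
  · exact Matrix.inv_smul' A (Units.mk0 c hc) h
  · have h' : ¬ IsUnit (c • A).det := by
      rw [isUnit_iff_ne_zero, not_not] at h ⊢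
      rw [Matrix.det_smul, h, mul_zero]
    rw [Matrix.nonsing_inv_apply_not_isUnit _ h, Matrix.nonsing_inv_apply_not_isUnit _ h',
      smul_zero]

/-- The factor `B` is itself invertible, so `B (BᵀB)⁻¹ Bᵀ = 1`. -/
lemma dotProduct_inv_transpose_mul_self {B : Matrix (Fin k) (Fin k) ℝ} (hB : IsUnit (Bᵀ * B))
    (z : Fin k → ℝ) : (Bᵀ *ᵥ z) ⬝ᵥ ((Bᵀ * B)⁻¹ *ᵥ (Bᵀ *ᵥ z)) = ∑ i, z i ^ 2 := by
  have hdet : IsUnit B.det := by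
    rw [Matrix.isUnit_iff_isUnit_det, Matrix.det_mul, Matrix.det_transpose] at hB
    exact isUnit_of_mul_isUnit_left hB
  have hdetT : IsUnit Bᵀ.det := by rwa [Matrix.det_transpose]
  rw [Matrix.mul_inv_rev, Matrix.mulVec_mulVec, Matrix.mul_assoc, Matrix.nonsing_inv_mul _ hdetT,
    Matrix.mul_one, ← Matrix.vecMul_transpose, Matrix.transpose_transpose,
    ← Matrix.dotProduct_mulVec, Matrix.mulVec_mulVec, Matrix.mul_nonsing_inv _ hdet,
    Matrix.one_mulVec]
  simp [dotProduct, sq]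

/-- The quadratic form `(v, A) ↦ vᵗ A v`. -/
def vecQuadForm (q : (Fin k → ℝ) × (Fin k → Fin k → ℝ)) : ℝ := q.1 ⬝ᵥ (Matrix.of q.2 *ᵥ q.1)

lemma continuous_vecQuadForm : Continuous (vecQuadForm (k := k)) := by
  unfold vecQuadForm dotProduct Matrix.mulVec dotProduct
  simp only [Matrix.of_apply]
  fun_prop

end MatrixInverse

/-! ### Normalization of the statistic -/

section Normalization

variable {J : Set ℝ} {k : ℕ} {μ : Measure (L2 J)}

/-- The vector `η` divided by `√(α² + β²)`. -/
def scaledEta (μ : Measure (L2 J)) (x y : ℕ → L2 J) (m n : ℕ) (g : Fin k → L2 J) : Fin k → ℝ :=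
  fun j => coefX m n * empProc μ x m (g j) + -coefY m n * empProc μ y n (g j)

/-- The statistic is unchanged by a simultaneous normalization of `η` and of the pooled sample
covariance matrix. -/
lemma quadForm_eq (x y : ℕ → L2 J) (m n : ℕ) (g : Fin k → L2 J) :
    quadForm μ μ x y m n g =
      vecQuadForm (scaledEta μ x y m n g, invEntries (pooledSampleCov x y m n g)) := by
  change _ = scaledEta μ x y m n g ⬝ᵥ ((pooledSampleCov x y m n g)⁻¹ *ᵥ scaledEta μ x y m n g)
  set c := alpha m n ^ 2 + beta m n ^ 2 with hc
  have hc0 : 0 ≤ c := by positivity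
  have heta : scaledEta μ x y m n g = (√c)⁻¹ • eta μ μ x y m n g := by
    ext j
    simp only [scaledEta, coefX, coefY, eta, Pi.smul_apply, smul_eq_mul, ← hc]
    ring
  have hpool : pooledCov x y m n g = c • pooledSampleCov x y m n g := by
    rw [pooledCov, pooledSampleCov, smul_smul, div_eq_mul_inv]
  -- The degenerate case occurs only for two empty samples, where division by zero gives `α = β =
  -- 0`.
  rcases hc0.eq_or_lt with h0 | hpos
  · have ha : alpha m n = 0 := by
      have : alpha m n ^ 2 = 0 := by linarith [sq_nonneg (alpha m n), sq_nonneg (beta m n)]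
      simpa using this
    have hb : beta m n = 0 := by
      have : beta m n ^ 2 = 0 := by linarith [sq_nonneg (alpha m n), sq_nonneg (beta m n)]
      simpa using this
    have he : eta μ μ x y m n g = 0 := by
      ext j; simp [eta, ha, hb]
    rw [heta, quadForm, he]
    simp
  · rw [heta, quadForm, hpool, inv_smul_of_ne_zero hpos.ne', Matrix.mulVec_smul,
      Matrix.smul_mulVec, dotProduct_smul, dotProduct_smul, smul_dotProduct, smul_smul, ← mul_inv,
      Real.mul_self_sqrt hc0]

lemma dotProduct_scaledEta (hi : Integrable (fun z : L2 J => z) μ) (x y : ℕ → L2 J) (m n : ℕ)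
    (g : Fin k → L2 J) (t : Fin k → ℝ) :
    t ⬝ᵥ scaledEta μ x y m n g = coefX m n * empProc μ x m (∑ j, t j • g j)
      + -coefY m n * empProc μ y n (∑ j, t j • g j) := by
  simp only [scaledEta, dotProduct, empProc_eq_inner hi, inner_sum, real_inner_smul_right,
    Finset.mul_sum, ← Finset.sum_add_distrib]
  exact Finset.sum_congr rfl fun j _ => by ring

/-- Cauchy–Schwarz with weights at most 1 in absolute value. The bound `‖s‖ ≤ ‖s‖² + 1` puts the
factor in the form controlled by the second moment estimate. -/
lemma norm_scaledEta_sub_le (hi : Integrable (fun z : L2 J => z) μ) (x y : ℕ → L2 J) (m n : ℕ)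
    (g h : Fin k → L2 J) :
    ‖scaledEta μ x y m n g - scaledEta μ x y m n h‖ ≤
      (‖normalizedSum μ x m‖ ^ 2 + ‖normalizedSum μ y n‖ ^ 2 + 2) * ‖g - h‖ := by
  refine (pi_norm_le_iff_of_nonneg (by positivity)).2 fun j => ?_
  have hj : ‖g j - h j‖ ≤ ‖g - h‖ := norm_le_pi_norm (g - h) j
  have h1 := abs_coefX_le_one m n
  have h2 := abs_coefY_le_one m n
  have key : (scaledEta μ x y m n g - scaledEta μ x y m n h) j
      = coefX m n * inner ℝ (normalizedSum μ x m) (g j - h j)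
        + -coefY m n * inner ℝ (normalizedSum μ y n) (g j - h j) := by
    simp only [Pi.sub_apply, scaledEta, empProc_eq_inner hi, inner_sub_right]
    ring
  have hle : ∀ (c : ℝ) (s : L2 J), |c| ≤ 1 →
      ‖c * inner ℝ s (g j - h j)‖ ≤ (‖s‖ ^ 2 + 1) * ‖g - h‖ := fun c s hcs => by
    rw [norm_mul, Real.norm_eq_abs]
    calc |c| * ‖inner ℝ s (g j - h j)‖ ≤ 1 * (‖s‖ * ‖g j - h j‖) := by
          gcongr
          exact norm_inner_le_norm _ _
      _ ≤ (‖s‖ ^ 2 + 1) * ‖g - h‖ := by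
          rw [one_mul]
          gcongr
          nlinarith [sq_nonneg (‖s‖ - 1), norm_nonneg s]
  rw [key]
  have hX := hle _ (normalizedSum μ x m) h1
  have hY := hle (-coefY m n) (normalizedSum μ y n) (by rwa [abs_neg])
  linarith [norm_add_le (coefX m n * inner ℝ (normalizedSum μ x m) (g j - h j))
    (-coefY m n * inner ℝ (normalizedSum μ y n) (g j - h j))]

end Normalization

/-! ### Measurability of the statistic -/

section Measurability

variable {Ω : Type*} [MeasurableSpace Ω] {P : Measure Ω} {J : Set ℝ} {k : ℕ} {μ : Measure (L2 J)}
  {X Y : ℕ → Ω → L2 J} {g : Fin k → Ω → L2 J}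

lemma aemeasurable_empProc (hi : Integrable (fun z : L2 J => z) μ)
    (hX : ∀ i, AEMeasurable (X i) P) {h : Ω → L2 J} (hh : AEMeasurable h P) (m : ℕ) :
    AEMeasurable (fun ω => empProc μ (fun i => X i ω) m (h ω)) P := by
  simp_rw [empProc_eq_inner hi]
  exact (aemeasurable_normalizedSum hX m).inner hh

lemma aemeasurable_scaledEta (hi : Integrable (fun z : L2 J => z) μ)
    (hX : ∀ i, AEMeasurable (X i) P) (hY : ∀ i, AEMeasurable (Y i) P)
    (hg : ∀ j, AEMeasurable (g j) P) (m n : ℕ) :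
    AEMeasurable (fun ω => scaledEta μ (fun i => X i ω) (fun i => Y i ω) m n fun j => g j ω) P :=
  aemeasurable_pi_lambda _ fun j => ((aemeasurable_empProc hi hX (hg j) m).const_mul _).add
    ((aemeasurable_empProc hi hY (hg j) n).const_mul _)

lemma aemeasurable_sampleCov (hX : ∀ i, AEMeasurable (X i) P) (hg : ∀ j, AEMeasurable (g j) P)
    (m : ℕ) (j l : Fin k) :
    AEMeasurable (fun ω => sampleCov (fun i => X i ω) m (fun j => g j ω) j l) P := by
  have hd : ∀ j i, AEMeasurable (fun ω => dotFun (g j ω) (X i ω)) P := fun j i =>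
    aemeasurable_dotFun (hg j) (hX i)
  have hs : ∀ j, AEMeasurable (fun ω => sampleMean (fun i => X i ω) m (g j ω)) P := fun j =>
    (Finset.aemeasurable_fun_sum _ fun i _ => hd j i).div_const _
  exact (Finset.aemeasurable_fun_sum _ fun i _ =>
    ((hd j i).sub (hs j)).mul ((hd l i).sub (hs l))).div_const _

lemma aemeasurable_invEntries_pooledSampleCov (hX : ∀ i, AEMeasurable (X i) P)
    (hY : ∀ i, AEMeasurable (Y i) P) (hg : ∀ j, AEMeasurable (g j) P) (m n : ℕ) :
    AEMeasurable (fun ω => invEntries (pooledSampleCov (fun i => X i ω) (fun i => Y i ω) m n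
      fun j => g j ω)) P := by
  refine measurable_invEntries.comp_aemeasurable (aemeasurable_pi_lambda _ fun j =>
    aemeasurable_pi_lambda _ fun l => ?_)
  exact (((aemeasurable_sampleCov hX hg m j l).const_mul _).add
    ((aemeasurable_sampleCov hY hg n j l).const_mul _)).const_mul _

lemma aemeasurable_quadForm (hi : Integrable (fun z : L2 J => z) μ)
    (hX : ∀ i, AEMeasurable (X i) P) (hY : ∀ i, AEMeasurable (Y i) P)
    (hg : ∀ j, AEMeasurable (g j) P) (m n : ℕ) :
    AEMeasurable (fun ω => quadForm μ μ (fun i => X i ω) (fun i => Y i ω) m n fun j => g j ω) P := by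
  simp_rw [quadForm_eq]
  exact continuous_vecQuadForm.measurable.comp_aemeasurable
    ((aemeasurable_scaledEta hi hX hY hg m n).prodMk
      (aemeasurable_invEntries_pooledSampleCov hX hY hg m n))

end Measurability

/-! ### Asymptotic distribution -/

section AsymptoticDistribution

variable {Ω Ω' : Type*} [MeasurableSpace Ω] [MeasurableSpace Ω'] {P : Measure Ω} {P' : Measure Ω'}
  [IsProbabilityMeasure P] [IsProbabilityMeasure P'] {J : Set ℝ} {μ : Measure (L2 J)}
  [IsProbabilityMeasure μ] {M : ℝ} {X Y : ℕ → Ω → L2 J} {m n : ℕ → ℕ} {k : ℕ}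
  {g : ℕ → Fin k → Ω → L2 J} {gInf : Fin k → L2 J} {p : ℝ}

/-- The central limit theorem for the empirical process at a fixed function. -/
lemma tendstoInDistribution_empProc (hμM : ∀ᵐ x ∂μ, ‖x‖ ^ 2 ≤ M) (hX : ∀ i, HasLaw (X i) μ P)
    (hind : iIndepFun X P) (hm : Tendsto m atTop atTop) (h : L2 J) {G : Ω' → ℝ}
    (hG : HasLaw G (gaussianReal 0 Var[dotFun h; μ].toNNReal) P') :
    TendstoInDistribution (fun N ω => empProc μ (fun i => X i ω) (m N) h) atTop G
      (fun _ => P) P' := by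
  have hmeas := measurable_dotFun h
  have hlaw : ∀ i, P.map (X i) = μ := fun i => (hX i).map_eq
  have hmean : P[fun ω => dotFun h (X 0 ω)] = ∫ z, dotFun h z ∂μ :=
    (hX 0).integral_comp hmeas.aestronglyMeasurable
  have hvar : Var[fun ω => dotFun h (X 0 ω); P] = Var[dotFun h; μ] := by
    rw [← hlaw 0, variance_map hmeas.aemeasurable (hX 0).aemeasurable]
    rfl
  have hL2 : MemLp (fun ω => dotFun h (X 0 ω)) 2 P :=
    (memLp_map_measure_iff hmeas.aestronglyMeasurable (hX 0).aemeasurable).1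
      (by rw [hlaw]; exact memLp_dotFun hμM h)
  have hclt := tendstoInDistribution_inv_sqrt_mul_sum_sub (P := P) (P' := P')
    (X := fun i ω => dotFun h (X i ω)) (Y := G) (by rw [hvar]; exact hG) hL2
    (hind.comp (fun _ => dotFun h) fun _ => hmeas)
    (fun i => IdentDistrib.comp (u := dotFun h)
      ⟨(hX i).aemeasurable, (hX 0).aemeasurable, by rw [hlaw, hlaw]⟩ hmeas)
  have heq : ∀ (N : ℕ), (fun ω => (√N)⁻¹ * (∑ i ∈ Finset.range N, dotFun h (X i ω)
      - N * P[fun ω => dotFun h (X 0 ω)])) = fun ω => empProc μ (fun i => X i ω) N h := fun N => by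
    ext ω
    rw [hmean, empProc, Finset.sum_sub_distrib]
    simp
  have hemp := hclt.congr (fun N => .of_eq (heq N)) (EventuallyEq.refl _ G)
  exact ⟨fun N => hemp.forall_aemeasurable (m N), hG.aemeasurable, hemp.tendsto.comp hm⟩

/-- By linearity, the combination with coefficients `t` is a weighted difference of two independent
empirical processes at the single function `∑ tⱼ gⱼ`, whose variance is `tᵗ BᵀB t = ‖Bt‖²`, the
variance of `t·Bᵀz`. -/
lemma tendstoInDistribution_scaledEta_const (hμM : ∀ᵐ x ∂μ, ‖x‖ ^ 2 ≤ M)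
    (hX : ∀ i, HasLaw (X i) μ P) (hY : ∀ i, HasLaw (Y i) μ P) (hXind : iIndepFun X P)
    (hYind : iIndepFun Y P) (hXY : IndepFun (fun ω i => X i ω) (fun ω i => Y i ω) P)
    (hm : Tendsto m atTop atTop) (hn : Tendsto n atTop atTop)
    (hp : Tendsto (fun N => (n N : ℝ) / ((n N : ℝ) + m N)) atTop (𝓝 p)) (hp0 : 0 ≤ p) (hp1 : p ≤ 1)
    {B : Matrix (Fin k) (Fin k) ℝ} (hB : covMatrix μ gInf = Bᵀ * B) :
    TendstoInDistribution
      (fun N ω => scaledEta μ (fun i => X i ω) (fun i => Y i ω) (m N) (n N) gInf) atTop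
      (fun z => Bᵀ *ᵥ z) (fun _ => P) (Measure.pi fun _ : Fin k => gaussianReal 0 1) := by
  have hi := integrable_id_of_norm_sq_le hμM
  refine tendstoInDistribution_of_forall_dotProduct (fun N => aemeasurable_scaledEta hi
    (fun i => (hX i).aemeasurable) (fun i => (hY i).aemeasurable)
    (fun _ => aemeasurable_const) _ _) ?_ fun t => ?_
  · have hc : Continuous fun z : Fin k → ℝ => Bᵀ *ᵥ z := by fun_prop
    exact hc.measurable.aemeasurable
  have hdot : ∀ z : Fin k → ℝ, t ⬝ᵥ (Bᵀ *ᵥ z) = (B *ᵥ t) ⬝ᵥ z := fun z => by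
    rw [Matrix.dotProduct_mulVec, Matrix.vecMul_transpose]
  have hvar : (B *ᵥ t) ⬝ᵥ (B *ᵥ t) = Var[dotFun (∑ j, t j • gInf j); μ] := by
    rw [← dotProduct_covMatrix_mulVec hμM, hB, ← Matrix.mulVec_mulVec, hdot]
  have hG := hasLaw_dotProduct_gaussian (B *ᵥ t)
  simp_rw [hdot, dotProduct_scaledEta hi]
  refine tendstoInDistribution_gaussian_add hG
    (tendstoInDistribution_empProc hμM hX hXind hm _ (by rw [← hvar]; exact hG))
    (tendstoInDistribution_empProc hμM hY hYind hn _ (by rw [← hvar]; exact hG))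
    (fun N => hXY.comp (measurable_empProc (m N) _) (measurable_empProc (n N) _))
    (tendsto_coefX hm hn hp) (tendsto_coefY hm hn hp).neg ?_
  rw [neg_sq, Real.sq_sqrt hp0, Real.sq_sqrt (by linarith)]
  ring

/-- Convergence in probability of the parameter does not affect the limit of the empirical
process: it is a linear functional of the parameter whose norm is bounded in `L²`. -/
lemma tendstoInMeasure_scaledEta_sub (hμM : ∀ᵐ x ∂μ, ‖x‖ ^ 2 ≤ M)
    (hX : ∀ i, HasLaw (X i) μ P) (hY : ∀ i, HasLaw (Y i) μ P) (hXind : iIndepFun X P)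
    (hYind : iIndepFun Y P)
    (hg : TendstoInMeasure P (fun N ω j => g N j ω) atTop fun _ => gInf) :
    TendstoInMeasure P
      ((fun N ω => scaledEta μ (fun i => X i ω) (fun i => Y i ω) (m N) (n N) fun j => g N j ω)
        - fun N ω => scaledEta μ (fun i => X i ω) (fun i => Y i ω) (m N) (n N) gInf)
      atTop 0 := by
  have hi := integrable_id_of_norm_sq_le hμM
  have hIX := fun N => integrable_norm_sq_normalizedSum_and_le hμM hX hXind (m N)
  have hIY := fun N => integrable_norm_sq_normalizedSum_and_le hμM hY hYind (n N)
  have hD : TendstoInMeasure P (fun N ω => ‖(fun j => g N j ω) - gInf‖) atTop 0 := by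
    rw [tendstoInMeasure_iff_norm] at hg ⊢
    simpa using hg
  have hprod := tendstoInMeasure_mul_of_integral_le (P := P)
    (R := fun N ω => ‖normalizedSum μ (fun i => X i ω) (m N)‖ ^ 2
      + ‖normalizedSum μ (fun i => Y i ω) (n N)‖ ^ 2 + 2)
    (K := (2 * √M) ^ 2 + (2 * √M) ^ 2 + 2) (fun N ω => by positivity)
    (fun N => ((hIX N).1.add (hIY N).1).add (integrable_const 2)) (fun N => by
      have hadd : Integrable (fun ω => ‖normalizedSum μ (fun i => X i ω) (m N)‖ ^ 2
          + ‖normalizedSum μ (fun i => Y i ω) (n N)‖ ^ 2) P := (hIX N).1.add (hIY N).1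
      rw [integral_add hadd (integrable_const 2), integral_add (hIX N).1 (hIY N).1]
      have h2 : ∫ _ω, (2 : ℝ) ∂P = 2 := by simp
      linarith [(hIX N).2, (hIY N).2]) hD
  rw [tendstoInMeasure_iff_norm] at hprod ⊢
  intro ε hε
  refine tendsto_of_tendsto_of_tendsto_of_le_of_le tendsto_const_nhds (hprod ε hε)
    (fun _ => zero_le) fun N => measure_mono fun ω hω => ?_
  simp only [Set.mem_ofPred_eq, Pi.zero_apply, sub_zero, Pi.sub_apply] at hω ⊢
  exact (hω.trans (norm_scaledEta_sub_le hi _ _ _ _ _ _)).trans (le_abs_self _)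

/-- The limit theorem along sequences for which the random functions converge almost surely and the
proportion of the sample sizes converges. -/
lemma tendstoInDistribution_quadForm_of_ae_tendsto (hμM : ∀ᵐ x ∂μ, ‖x‖ ^ 2 ≤ M)
    (hX : ∀ i, HasLaw (X i) μ P) (hY : ∀ i, HasLaw (Y i) μ P) (hXind : iIndepFun X P)
    (hYind : iIndepFun Y P) (hXY : IndepFun (fun ω i => X i ω) (fun ω i => Y i ω) P)
    (hm : Tendsto m atTop atTop) (hn : Tendsto n atTop atTop)
    (hp : Tendsto (fun N => (n N : ℝ) / ((n N : ℝ) + m N)) atTop (𝓝 p)) (hp0 : 0 ≤ p) (hp1 : p ≤ 1)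
    (hgmeas : ∀ N j, AEMeasurable (g N j) P)
    (hg : ∀ᵐ ω ∂P, Tendsto (fun N j => g N j ω) atTop (𝓝 gInf))
    (hcov : IsUnit (covMatrix μ gInf)) :
    TendstoInDistribution
      (fun N ω => quadForm μ μ (fun i => X i ω) (fun i => Y i ω) (m N) (n N) fun j => g N j ω)
      atTop (fun z => ∑ i, z i ^ 2) (fun _ => P) (Measure.pi fun _ : Fin k => gaussianReal 0 1) := by
  have hi := integrable_id_of_norm_sq_le hμM
  have hXm := fun i => (hX i).aemeasurable
  have hYm := fun i => (hY i).aemeasurable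
  obtain ⟨B, hB⟩ := exists_transpose_mul_self_eq_covMatrix hμM gInf
  have hgP : TendstoInMeasure P (fun N ω j => g N j ω) atTop fun _ => gInf :=
    tendstoInMeasure_of_tendsto_ae
      (fun N => (aemeasurable_pi_lambda _ (hgmeas N)).aestronglyMeasurable) hg
  have heta := tendstoInDistribution_of_tendstoInMeasure_sub _ _
    (tendstoInDistribution_scaledEta_const hμM hX hY hXind hYind hXY hm hn hp hp0 hp1 hB)
    (tendstoInMeasure_scaledEta_sub hμM hX hY hXind hYind hgP)
    (fun N => aemeasurable_scaledEta hi hXm hYm (hgmeas N) _ _)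
  have hinvm := fun N => aemeasurable_invEntries_pooledSampleCov hXm hYm (hgmeas N) (m N) (n N)
  have hop : Integrable (fun z : L2 J => rankOneOp z) μ := integrable_rankOneOp hμM
  have hinv : TendstoInMeasure P (fun N ω => invEntries (pooledSampleCov (fun i => X i ω)
      (fun i => Y i ω) (m N) (n N) fun j => g N j ω)) atTop
      fun _ => invEntries (covMatrix μ gInf) := by
    refine tendstoInMeasure_of_tendsto_ae (fun N => (hinvm N).aestronglyMeasurable) ?_
    filter_upwards [hg, ae_tendsto_average continuous_id hi hX hXind,
      ae_tendsto_average continuous_id hi hY hYind,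
      ae_tendsto_average continuous_rankOneOp hop hX hXind,
      ae_tendsto_average continuous_rankOneOp hop hY hYind] with ω hgω hX1 hY1 hX2 hY2
    exact tendsto_invEntries (tendsto_pooledSampleCov hμM hX1 hX2 hY1 hY2 hm hn hp
      (tendsto_pi_nhds.1 hgω)) hcov
  -- Slutsky: the inverse matrices have a constant limit, so they converge jointly with the vectors.
  have hQ := heta.continuous_comp_prodMk_of_tendstoInMeasure_const continuous_vecQuadForm hinv hinvm
  simp_rw [quadForm_eq]
  have hlim : ∀ z : Fin k → ℝ, vecQuadForm (Bᵀ *ᵥ z, invEntries (covMatrix μ gInf))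
      = ∑ i, z i ^ 2 := fun z => by
    rw [hB] at hcov ⊢
    exact dotProduct_inv_transpose_mul_self hcov z
  simpa only [hlim] using hQ

end AsymptoticDistribution

/-- Convergence in measure in a finite product follows from convergence in measure of the
coordinates. -/
lemma tendstoInMeasure_pi {Ω ι κ E : Type*} [MeasurableSpace Ω] {P : Measure Ω} [Fintype κ]
    [PseudoEMetricSpace E] {l : Filter ι} {f : ι → κ → Ω → E} {f₀ : κ → Ω → E}
    (h : ∀ j, TendstoInMeasure P (fun N => f N j) l (f₀ j)) :
    TendstoInMeasure P (fun N ω j => f N j ω) l fun ω j => f₀ j ω := by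
  intro ε hε
  have hsum : Tendsto (fun N => ∑ j, P {ω | ε ≤ edist (f N j ω) (f₀ j ω)}) l (𝓝 0) := by
    simpa using tendsto_finsetSum Finset.univ fun j _ => h j ε hε
  refine tendsto_of_tendsto_of_tendsto_of_le_of_le tendsto_const_nhds hsum (fun _ => zero_le)
    fun N => ?_
  refine (measure_mono fun ω hω => ?_).trans (measure_iUnion_fintype_le P _)
  simp only [Set.mem_ofPred_eq, edist_pi_def, Set.mem_iUnion] at hω ⊢
  obtain ⟨j, -, hj⟩ := (Finset.le_sup_iff hε).1 hω
  exact ⟨j, hj⟩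

end TwoSample

end

theorem proposition2 {Ω : Type*} [MeasurableSpace Ω] (P : Measure Ω) [IsProbabilityMeasure P]
    -- the interval `J`, the laws `ℒ(X)`, `ℒ(Y)` on `L²(J)` and the two independent i.i.d. samples
    (J : Set ℝ) (hJ : J.OrdConnected)
    (μX μY : Measure (TwoSample.L2 J)) (X Y : ℕ → Ω → TwoSample.L2 J)
    (hXlaw : ∀ i, HasLaw (X i) μX P) (hYlaw : ∀ i, HasLaw (Y i) μY P)
    (hXindep : iIndepFun X P) (hYindep : iIndepFun Y P)
    (hXY : IndepFun (fun ω i => X i ω) (fun ω i => Y i ω) P)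
    -- the null hypothesis
    (hH0 : μX = μY)
    -- the class `𝒢`, with the conditions (i) envelope, (ii) bounded norm, (iii) entropy
    (𝒢 : Set (TwoSample.L2 J)) (F : ℝ → ℝ) (hF : MemLp F 2 (volume.restrict J))
    (hFenv : ∀ g ∈ 𝒢, ∀ᵐ t ∂(volume.restrict J), |g t| < F t)
    (M : ℝ) (hM : 0 < M) (hXM : ∀ᵐ x ∂μX, ‖x‖ ^ 2 ≤ M)
    (hentropy : TwoSample.PollardEntropy (√(∫ t in J, F t ^ 2)) 𝒢)
    -- sample sizes tending to infinity
    (m n : ℕ → ℕ) (hm : Tendsto m atTop atTop) (hn : Tendsto n atTop atTop)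
    -- the random functions `g̃_1, …, g̃_k` in `𝒢` and their limits in probability in `L²(J)`
    (k : ℕ) (g : ℕ → Fin k → Ω → TwoSample.L2 J)
    (hgmeas : ∀ N j, AEMeasurable (g N j) P) (hg𝒢 : ∀ N j, ∀ᵐ ω ∂P, g N j ω ∈ 𝒢)
    (gInf : Fin k → TwoSample.L2 J)
    (hglim : ∀ j, TendstoInMeasure P (fun N => g N j) atTop (fun _ => gInf j))
    (hcov : IsUnit (TwoSample.covMatrix μX gInf)) :
    TendstoInDistribution
      (fun N ω => TwoSample.quadForm μX μY (fun i => X i ω) (fun i => Y i ω) (m N) (n N)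
        (fun j => g N j ω))
      atTop (id : ℝ → ℝ) (fun _ => P) (TwoSample.chiSquare k) := by
  subst hH0
  have hμ : IsProbabilityMeasure μX :=
    (hXlaw 0).map_eq ▸ Measure.isProbabilityMeasure_map (hXlaw 0).aemeasurable
  have hi := TwoSample.integrable_id_of_norm_sq_le hXM
  have hglim' := TwoSample.tendstoInMeasure_pi hglim
  refine ⟨fun N => TwoSample.aemeasurable_quadForm hi (fun i => (hXlaw i).aemeasurable)
    (fun i => (hYlaw i).aemeasurable) (hgmeas N) _ _, aemeasurable_id, ?_⟩
  -- It suffices that every subsequence has a further one with the required limit.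
  refine tendsto_of_subseq_tendsto fun ns hns => ?_
  obtain ⟨ms, hms, hae⟩ := (hglim'.comp hns).exists_seq_tendsto_ae
  set u : ℕ → ℕ := fun N => ns (ms N) with hu
  have hut : Tendsto u atTop atTop := hns.comp hms.tendsto_atTop
  have hmem : ∀ N, (n (u N) : ℝ) / ((n (u N) : ℝ) + m (u N)) ∈ Set.Icc (0 : ℝ) 1 := fun N =>
    ⟨by positivity, div_le_one_of_le₀ (by linarith [Nat.cast_nonneg (α := ℝ) (m (u N))])
      (by positivity)⟩
  -- The proportions need not converge; compactness of `[0, 1]` provides a limit `p`, possibly 0 or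
  -- 1.
  obtain ⟨p, ⟨hp0, hp1⟩, φ, hφ, hpφ⟩ := isCompact_Icc.tendsto_subseq hmem
  have hφt := hφ.tendsto_atTop
  have hcore := TwoSample.tendstoInDistribution_quadForm_of_ae_tendsto (P := P)
    (m := fun N => m (u (φ N))) (n := fun N => n (u (φ N))) (g := fun N => g (u (φ N))) hXM hXlaw
    hYlaw hXindep hYindep hXY (hm.comp (hut.comp hφt)) (hn.comp (hut.comp hφt)) hpφ hp0 hp1
    (fun N => hgmeas _)
    (by filter_upwards [hae] with ω hω using hω.comp hφt) hcov
  refine ⟨fun N => ms (φ N), ?_⟩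
  convert hcore.tendsto using 2
  exact congrArg 𝓝 (Subtype.ext Measure.map_id)
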